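/- For a compact convex set $S\subset\mathbb{C}$ (with $\mathbb{C}$ identified with the Euclidean plane), let the perimeter of $S$ be the length (one-dimensional Hausdorff measure) of its boundary $\partial S$ if $S$ has nonempty interior, and twice the length of $S$ if $S$ has empty interior, i.e. twice the length of a segment, and $0$ for a single point. Let $S_1,S_2\subset\mathbb{C}$ be nonempty compact convex sets, and let $S_1+S_2=\{x+y : x\in S_1,\ y\in S_2\}$ be their Minkowski sum. Then $S_1$ and $S_2$ have finite perimeter and $$\text{perimeter of }(S_1+S_2)=\text{perimeter of }S_1+\text{perimeter of }S_2 .$$ -/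

import Mathlib

open MeasureTheory
open scoped Pointwise ENNReal

/-- Perimeter of a compact convex set `S` in the complex plane: the length (one-dimensional
Hausdorff measure, which Mathlib normalizes so that a segment has its Euclidean length) of the
boundary curve. A set with empty interior (a segment or a point) is a degenerate convex region
whose boundary curve runs through it twice, back and forth, so it counts with twice its length. -/
noncomputable def perimeter (S : Set ℂ) : ℝ≥0∞ :=
  open scoped Classical in
  if (interior S).Nonempty then μH[1] (frontier S) else 2 * μH[1] S

/-! Support functions add under Minkowski sums, and the perimeter is a limit of expressions linear
in the support function h. With N equally spaced normals and η = π / N, this expression is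
`polygonSum K N`, the sum of sin η * (h(θ_i) + h(θ_{i+1})). It is additive in K (`polygonSum_add`),
so `tendsto_polygonSum` and uniqueness of limits give the theorem.

For K with interior, the boundary is cut into the face with normal angle 0 and N pieces, each swept
by normals turning through 2η. Seen from the middle normal of a piece, the tangential coordinate is
1-Lipschitz and has an inverse with Lipschitz constant 1 / cos η. The length of the piece therefore
lies between its tangential displacement and that displacement divided by cos η. Writing the
displacements in the frames of the cutting normals makes the tangential terms telescope and leaves
the support values, so the perimeter lies between `polygonSum K N` and `polygonSum K N / cos η`
(`hausdorffMeasure_frontier_bounds`).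

A set without interior is a degenerate rectangle. Adding a unit square gives a genuine rectangle,
and additivity of `polygonSum` recovers the limit by subtraction. -/

/-- The coordinate of `z` in the direction `exp (θ * I)`. -/
noncomputable def dirFun (θ : ℝ) (z : ℂ) : ℝ := z.re * Real.cos θ + z.im * Real.sin θ

/-- The coordinate of `z` in the direction `I * exp (θ * I)`. -/
noncomputable def tanFun (θ : ℝ) (z : ℂ) : ℝ := z.im * Real.cos θ - z.re * Real.sin θ

/-- The face of `K` with outer normal `exp (θ * I)`. -/
def face (K : Set ℂ) (θ : ℝ) : Set ℂ := {x | x ∈ K ∧ ∀ y ∈ K, dirFun θ y ≤ dirFun θ x}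

/-- The support function of `K`. -/
noncomputable def supportFun (K : Set ℂ) (θ : ℝ) : ℝ := sSup (dirFun θ '' K)

/-- The points of `K` having an outer normal with angle in `[s, t]`. -/
def arc (K : Set ℂ) (s t : ℝ) : Set ℂ := {x | ∃ θ ∈ Set.Icc s t, x ∈ face K θ}

/-! ### Coordinates in a rotated frame. -/

lemma continuous_dirFun : Continuous fun p : ℝ × ℂ => dirFun p.1 p.2 := by
  unfold dirFun; fun_prop

lemma continuous_tanFun (θ : ℝ) : Continuous (tanFun θ) := by
  unfold tanFun; fun_prop

lemma dirFun_add (θ : ℝ) (x y : ℂ) : dirFun θ (x + y) = dirFun θ x + dirFun θ y := by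
  simp [dirFun]; ring

lemma tanFun_sub (θ : ℝ) (x y : ℂ) : tanFun θ (x - y) = tanFun θ x - tanFun θ y := by
  simp [tanFun]; ring

lemma dirFun_sub (θ : ℝ) (x y : ℂ) : dirFun θ (x - y) = dirFun θ x - dirFun θ y := by
  simp [dirFun]; ring

lemma dirFun_angle_add (θ α : ℝ) (z : ℂ) :
    dirFun (θ + α) z = Real.cos α * dirFun θ z + Real.sin α * tanFun θ z := by
  simp only [dirFun, tanFun, Real.cos_add, Real.sin_add]; ring

lemma tanFun_angle_add (θ α : ℝ) (z : ℂ) :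
    tanFun (θ + α) z = Real.cos α * tanFun θ z - Real.sin α * dirFun θ z := by
  simp only [dirFun, tanFun, Real.cos_add, Real.sin_add]; ring

lemma dirFun_add_two_pi (θ : ℝ) (z : ℂ) : dirFun (θ + 2 * Real.pi) z = dirFun θ z := by
  simp [dirFun]

lemma tanFun_add_two_pi (θ : ℝ) (z : ℂ) : tanFun (θ + 2 * Real.pi) z = tanFun θ z := by
  simp [tanFun]

lemma sq_dirFun_add_sq_tanFun (θ : ℝ) (z : ℂ) :
    dirFun θ z ^ 2 + tanFun θ z ^ 2 = ‖z‖ ^ 2 := by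
  rw [← Complex.normSq_eq_norm_sq, Complex.normSq_apply]
  simp only [dirFun, tanFun]
  linear_combination (z.re ^ 2 + z.im ^ 2) * Real.cos_sq_add_sin_sq θ

lemma abs_tanFun_le (θ : ℝ) (z : ℂ) : |tanFun θ z| ≤ ‖z‖ := by
  apply abs_le_of_sq_le_sq _ (norm_nonneg z)
  nlinarith [sq_dirFun_add_sq_tanFun θ z, sq_nonneg (dirFun θ z)]

lemma sin_mul_dirFun (a b c : ℝ) (z : ℂ) :
    Real.sin (c - a) * dirFun b z
      = Real.sin (b - a) * dirFun c z + Real.sin (c - b) * dirFun a z := by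
  simp only [dirFun, Real.sin_sub]
  ring

/-! ### Faces and arcs of the boundary. -/

lemma face_add_two_pi (K : Set ℂ) (θ : ℝ) : face K (θ + 2 * Real.pi) = face K θ := by
  simp [face, dirFun_add_two_pi]

lemma face_two_pi (K : Set ℂ) : face K (2 * Real.pi) = face K 0 := by
  rw [← face_add_two_pi K 0, zero_add]

lemma face_nonempty {K : Set ℂ} (hne : K.Nonempty) (hK : IsCompact K) (θ : ℝ) :
    (face K θ).Nonempty := by
  obtain ⟨x, hx, h⟩ := hK.exists_isMaxOn hne
    (f := dirFun θ) (continuous_dirFun.comp (by fun_prop : Continuous fun z : ℂ => (θ, z))).continuousOn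
  exact ⟨x, hx, fun y hy => h hy⟩

/-- Faces jump with the angle, so a closed graph takes the place of continuity. -/
lemma isClosed_setOf_mem_face {K : Set ℂ} (hK : IsClosed K) :
    IsClosed {p : ℝ × ℂ | p.2 ∈ face K p.1} := by
  have : {p : ℝ × ℂ | p.2 ∈ face K p.1}
      = Prod.snd ⁻¹' K ∩ ⋂ y ∈ K, {p : ℝ × ℂ | dirFun p.1 y ≤ dirFun p.1 p.2} := by
    ext p; simp [face]
  rw [this]
  refine (hK.preimage continuous_snd).inter (isClosed_biInter fun y _ => isClosed_le ?_ ?_)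
  · exact continuous_dirFun.comp (by fun_prop : Continuous fun p : ℝ × ℂ => (p.1, y))
  · exact continuous_dirFun

lemma isClosed_face {K : Set ℂ} (hK : IsClosed K) (θ : ℝ) : IsClosed (face K θ) :=
  (isClosed_setOf_mem_face hK).preimage (by fun_prop : Continuous fun z : ℂ => (θ, z))

lemma isCompact_face {K : Set ℂ} (hK : IsCompact K) (θ : ℝ) : IsCompact (face K θ) :=
  hK.of_isClosed_subset (isClosed_face hK.isClosed θ) fun _ h => h.1

lemma convex_face {K : Set ℂ} (hK : Convex ℝ K) (θ : ℝ) : Convex ℝ (face K θ) := by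
  intro x hx y hy a b ha hb hab
  refine ⟨hK hx.1 hy.1 ha hb hab, fun z hz => ?_⟩
  have h1 := hx.2 z hz
  have h2 := hy.2 z hz
  have : dirFun θ (a • x + b • y) = a * dirFun θ x + b * dirFun θ y := by
    simp [dirFun]; ring
  rw [this]
  calc dirFun θ z = a * dirFun θ z + b * dirFun θ z := by rw [← add_mul, hab, one_mul]
    _ ≤ _ := by gcongr

lemma isCompact_arc {K : Set ℂ} (hK : IsCompact K) (s t : ℝ) : IsCompact (arc K s t) := by
  have : arc K s t
      = Prod.snd '' ((Set.Icc s t ×ˢ K) ∩ {p : ℝ × ℂ | p.2 ∈ face K p.1}) := by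
    ext x
    constructor
    · rintro ⟨θ, h, hx⟩
      exact ⟨(θ, x), ⟨⟨h, hx.1⟩, hx⟩, rfl⟩
    · rintro ⟨⟨θ, x⟩, ⟨⟨h, -⟩, hx⟩, rfl⟩
      exact ⟨θ, h, hx⟩
  rw [this]
  exact ((isCompact_Icc.prod hK).inter_right (isClosed_setOf_mem_face hK.isClosed)).image
    continuous_snd

lemma isClosed_setOf_exists_face {K A : Set ℂ} (hK : IsCompact K) (hA : IsClosed A) (s t : ℝ) :
    IsClosed {θ | θ ∈ Set.Icc s t ∧ ∃ x ∈ face K θ, x ∈ A} := by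
  have : {θ | θ ∈ Set.Icc s t ∧ ∃ x ∈ face K θ, x ∈ A}
      = Prod.fst '' ((Set.Icc s t ×ˢ (K ∩ A)) ∩ {p : ℝ × ℂ | p.2 ∈ face K p.1}) := by
    ext θ
    constructor
    · rintro ⟨h, x, hx, hxA⟩
      exact ⟨(θ, x), ⟨⟨h, hx.1, hxA⟩, hx⟩, rfl⟩
    · rintro ⟨⟨θ, x⟩, ⟨⟨h, -, hxA⟩, hx⟩, rfl⟩
      exact ⟨h, x, hx, hxA⟩
  rw [this]
  exact (((isCompact_Icc.prod (hK.inter_right hA)).inter_right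
    (isClosed_setOf_mem_face hK.isClosed)).image continuous_fst).isClosed

/-- The tangential coordinate takes every intermediate value on an arc. -/
lemma exists_mem_arc_tanFun_eq {K : Set ℂ} (hne : K.Nonempty) (hK : IsCompact K)
    (hconv : Convex ℝ K) {s t m v : ℝ} (hst : s ≤ t) {p q : ℂ} (hp : p ∈ face K s)
    (hq : q ∈ face K t) (hpv : tanFun m p ≤ v) (hvq : v ≤ tanFun m q) :
    ∃ x ∈ arc K s t, tanFun m x = v := by
  have hA := isClosed_setOf_exists_face hK
    (isClosed_le (continuous_tanFun m) continuous_const : IsClosed {x | tanFun m x ≤ v}) s t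
  have hB := isClosed_setOf_exists_face hK
    (isClosed_le continuous_const (continuous_tanFun m) : IsClosed {x | v ≤ tanFun m x}) s t
  -- The angles whose face meets `tanFun m ≤ v` and those whose face meets `v ≤ tanFun m` are closed
  -- sets covering the connected interval. Some face thus meets both, and it is itself connected.
  obtain ⟨θ, hθ, ⟨-, x, hx, hxv⟩, ⟨-, y, hy, hyv⟩⟩ :=
    isPreconnected_closed_iff.1 (isPreconnected_Icc (a := s) (b := t)) _ _ hA hB
      (fun θ hθ => by
        obtain ⟨x, hx⟩ := face_nonempty hne hK θ
        rcases le_total (tanFun m x) v with h | h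
        · exact Or.inl ⟨hθ, x, hx, h⟩
        · exact Or.inr ⟨hθ, x, hx, h⟩)
      ⟨s, Set.left_mem_Icc.2 hst, Set.left_mem_Icc.2 hst, p, hp, hpv⟩
      ⟨t, Set.right_mem_Icc.2 hst, Set.right_mem_Icc.2 hst, q, hq, hvq⟩
  obtain ⟨z, hz, hzv⟩ := (convex_face hconv θ).isPreconnected.intermediate_value hx hy
    (continuous_tanFun m).continuousOn ⟨hxv, hyv⟩
  exact ⟨z, ⟨θ, hθ, hz⟩, hzv⟩

/-! ### Length of an arc seen from its middle normal. -/

/-- On an arc of small angle the tangential coordinate is antilipschitz. -/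
lemma cos_mul_norm_sub_le {K : Set ℂ} {m η : ℝ} (hη : η < Real.pi / 2) {x y : ℂ}
    (hx : x ∈ arc K (m - η) (m + η)) (hy : y ∈ arc K (m - η) (m + η)) :
    Real.cos η * ‖x - y‖ ≤ |tanFun m (x - y)| := by
  -- The supporting line at `y` is tilted by at most η from the one with normal angle m, and `x`
  -- lies behind it.
  have key : ∀ {x y : ℂ}, x ∈ arc K (m - η) (m + η) → y ∈ arc K (m - η) (m + η) →
      Real.cos η * dirFun m (x - y) ≤ Real.sin η * |tanFun m (x - y)| := by
    rintro x y ⟨_, -, hx⟩ ⟨φ, ⟨h1, h2⟩, hy⟩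
    have h := hy.2 x hx.1
    rw [← sub_nonpos, ← dirFun_sub, show φ = m + (φ - m) by ring, dirFun_angle_add] at h
    set β := φ - m
    have hb1 : -η ≤ β := by linarith
    have hb2 : β ≤ η := by linarith
    have hcη : 0 < Real.cos η := Real.cos_pos_of_mem_Ioo ⟨by linarith, hη⟩
    have hcβ : 0 < Real.cos β := Real.cos_pos_of_mem_Ioo ⟨by linarith, by linarith⟩
    have hs1 : 0 ≤ Real.sin (η - β) :=
      Real.sin_nonneg_of_nonneg_of_le_pi (by linarith) (by linarith)
    have hs2 : 0 ≤ Real.sin (η + β) :=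
      Real.sin_nonneg_of_nonneg_of_le_pi (by linarith) (by linarith)
    rw [Real.sin_sub] at hs1
    rw [Real.sin_add] at hs2
    set a := dirFun m (x - y)
    set b := tanFun m (x - y)
    refine le_of_mul_le_mul_left ?_ hcβ
    have h3 : Real.cos β * (Real.cos η * a) ≤ Real.cos η * (-(Real.sin β * b)) := by nlinarith
    refine h3.trans ?_
    rcases abs_cases b with ⟨hb, hb0⟩ | ⟨hb, hb0⟩ <;> rw [hb] <;> nlinarith
  have h1 := key hx hy
  have h2 := key hy hx
  have e1 : dirFun m (y - x) = - dirFun m (x - y) := by simp only [dirFun_sub]; ring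
  have e2 : tanFun m (y - x) = - tanFun m (x - y) := by simp only [tanFun_sub]; ring
  rw [e1, e2, abs_neg] at h2
  obtain ⟨θ, ⟨h3, h4⟩, -⟩ := hx
  have hcη : 0 < Real.cos η := Real.cos_pos_of_mem_Ioo ⟨by linarith, hη⟩
  -- Both orders of the two points bound the absolute value of the normal component; Pythagoras then
  -- concludes.
  have hsq : (Real.cos η * dirFun m (x - y)) ^ 2 ≤ (Real.sin η * |tanFun m (x - y)|) ^ 2 :=
    sq_le_sq' (by linarith) h1
  refine le_of_sq_le_sq ?_ (abs_nonneg _)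
  rw [mul_pow, ← sq_dirFun_add_sq_tanFun m (x - y)]
  rw [mul_pow, mul_pow, sq_abs] at hsq
  rw [sq_abs]
  nlinarith [Real.sin_sq_add_cos_sq η]

/-- By the antilipschitz bound, `X` is the image of a subset of [a, b] under a map with Lipschitz
constant 1 / cos η. -/
lemma hausdorffMeasure_le_of_subset_arc {K X : Set ℂ} {m η a b : ℝ} (hη0 : 0 ≤ η)
    (hη : η < Real.pi / 2) (hX : X ⊆ arc K (m - η) (m + η))
    (hab : ∀ x ∈ X, tanFun m x ∈ Set.Icc a b) :
    μH[1] X ≤ ENNReal.ofReal ((b - a) / Real.cos η) := by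
  have hc : 0 < Real.cos η := Real.cos_pos_of_mem_Ioo ⟨by linarith, hη⟩
  have hinj : Set.InjOn (tanFun m) X := by
    intro x hx y hy hxy
    have := cos_mul_norm_sub_le hη (hX hx) (hX hy)
    rw [tanFun_sub, hxy, sub_self, abs_zero] at this
    have h0 : ‖x - y‖ ≤ 0 := by
      by_contra! h
      nlinarith [mul_pos hc h]
    exact sub_eq_zero.1 (norm_le_zero_iff.1 h0)
  set g := Function.invFunOn (tanFun m) X
  have hg : ∀ x ∈ X, g (tanFun m x) = x := fun x hx => hinj.leftInvOn_invFunOn hx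
  have hlip : LipschitzOnWith (Real.toNNReal (Real.cos η)⁻¹) g (tanFun m '' X) := by
    refine LipschitzOnWith.of_dist_le_mul ?_
    rintro _ ⟨x, hx, rfl⟩ _ ⟨y, hy, rfl⟩
    rw [hg x hx, hg y hy, Real.coe_toNNReal _ (by positivity), Real.dist_eq, Complex.dist_eq,
      ← tanFun_sub, inv_mul_eq_div, le_div_iff₀ hc, mul_comm]
    exact cos_mul_norm_sub_le hη (hX hx) (hX hy)
  have himg : g '' (tanFun m '' X) = X := by
    rw [Set.image_image]
    ext x
    constructor
    · rintro ⟨y, hy, rfl⟩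
      simpa [hg y hy] using hy
    · intro hx
      exact ⟨x, hx, hg x hx⟩
  have h := hlip.hausdorffMeasure_image_le (d := 1) zero_le_one
  rw [himg, hausdorffMeasure_real, ENNReal.rpow_one] at h
  refine h.trans ?_
  have h2 : volume (tanFun m '' X) ≤ ENNReal.ofReal (b - a) := by
    rw [← Real.volume_Icc]
    exact measure_mono (Set.image_subset_iff.2 hab)
  calc _ ≤ ENNReal.ofReal (Real.cos η)⁻¹ * ENNReal.ofReal (b - a) := by
        gcongr; exact le_rfl
    _ = _ := by
        rw [← ENNReal.ofReal_mul (by positivity)]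
        congr 1; field_simp

/-- The tangential coordinate is 1-Lipschitz. One value `c` may be missed: it allows for a boundary
point already counted in an earlier piece. -/
lemma le_hausdorffMeasure_of_tanFun {X : Set ℂ} {m a b c : ℝ}
    (h : Set.Ioo a b \ {c} ⊆ tanFun m '' X) : ENNReal.ofReal (b - a) ≤ μH[1] X := by
  have hlip : LipschitzWith 1 (tanFun m) := by
    refine LipschitzWith.of_dist_le_mul fun x y => ?_
    rw [Real.dist_eq, ← tanFun_sub, NNReal.coe_one, one_mul, Complex.dist_eq]
    exact abs_tanFun_le _ _
  have h1 := hlip.hausdorffMeasure_image_le (d := 1) zero_le_one X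
  rw [hausdorffMeasure_real, ENNReal.coe_one, ENNReal.one_rpow, one_mul] at h1
  refine le_trans ?_ h1
  rw [← Real.volume_Ioo, ← measure_sdiff_null (s := Set.Ioo a b) (Real.volume_singleton (a := c))]
  exact measure_mono h

/-- Along an arc the tangential coordinate increases with the angle of the normal. -/
lemma tanFun_le_of_mem_face {K : Set ℂ} {m η θ φ : ℝ} (hη : η < Real.pi / 2)
    (hθ : m - η ≤ θ) (hθφ : θ < φ) (hφ : φ ≤ m + η) {x y : ℂ} (hx : x ∈ face K θ)
    (hy : y ∈ face K φ) : tanFun m x ≤ tanFun m y := by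
  have h1 := hx.2 y hy.1
  have h2 := hy.2 x hx.1
  rw [← sub_nonpos, ← dirFun_sub, show θ = m + (θ - m) by ring, dirFun_angle_add] at h1
  rw [← sub_nonneg, ← dirFun_sub, show φ = m + (φ - m) by ring, dirFun_angle_add] at h2
  have hcθ : 0 < Real.cos (θ - m) := Real.cos_pos_of_mem_Ioo ⟨by linarith, by linarith⟩
  have hcφ : 0 < Real.cos (φ - m) := Real.cos_pos_of_mem_Ioo ⟨by linarith, by linarith⟩
  have hs : 0 < Real.sin ((φ - m) - (θ - m)) :=
    Real.sin_pos_of_pos_of_lt_pi (by linarith) (by linarith)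
  have e2 : dirFun m (y - x) = - dirFun m (x - y) := by simp only [dirFun_sub]; ring
  rw [← sub_nonneg, ← tanFun_sub]
  -- Multiplying the two support inequalities by each other's cosine eliminates `dirFun m` and
  -- leaves sin(φ - θ) times the tangential difference.
  by_contra! hneg
  rw [Real.sin_sub] at hs
  nlinarith [mul_le_mul_of_nonneg_left h1 hcφ.le, mul_nonneg h2 hcθ.le, mul_pos_of_neg_of_neg hneg (neg_lt_zero.2 hs)]

/-- `dirFun θ` is constant on the face, so turning the frame only scales tangential differences by
cos(m - θ) ≥ 0. -/
lemma tanFun_le_of_mem_same_face {K : Set ℂ} {m θ : ℝ} (hθ : |m - θ| ≤ Real.pi / 2) {x y : ℂ}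
    (hx : x ∈ face K θ) (hy : y ∈ face K θ) (h : tanFun θ x ≤ tanFun θ y) :
    tanFun m x ≤ tanFun m y := by
  have e : dirFun θ x = dirFun θ y := le_antisymm (hy.2 x hx.1) (hx.2 y hy.1)
  have hc : 0 ≤ Real.cos (m - θ) := by
    obtain ⟨h1, h2⟩ := abs_le.1 hθ
    exact Real.cos_nonneg_of_mem_Icc ⟨h1, h2⟩
  rw [show m = θ + (m - θ) by ring, tanFun_angle_add, tanFun_angle_add, e]
  have := mul_le_mul_of_nonneg_left h hc
  linarith

/-! ### Outer normals and the frontier. -/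

/-- The direction at b is a nonnegative combination of those at a and c (`sin_mul_dirFun`), so a
maximizer for both is one for b. -/
lemma mem_face_of_mem_face {K : Set ℂ} {a b c : ℝ} (hab : a ≤ b) (hbc : b ≤ c) (hac : a < c)
    (hπ : c - a < Real.pi) {x : ℂ} (ha : x ∈ face K a) (hc : x ∈ face K c) : x ∈ face K b := by
  refine ⟨ha.1, fun y hy => ?_⟩
  have hs : 0 < Real.sin (c - a) := Real.sin_pos_of_pos_of_lt_pi (by linarith) hπ
  have h1 : 0 ≤ Real.sin (b - a) :=
    Real.sin_nonneg_of_nonneg_of_le_pi (by linarith) (by linarith)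
  have h2 : 0 ≤ Real.sin (c - b) :=
    Real.sin_nonneg_of_nonneg_of_le_pi (by linarith) (by linarith)
  refine le_of_mul_le_mul_left ?_ hs
  rw [sin_mul_dirFun a b c y, sin_mul_dirFun a b c x]
  have := ha.2 y hy
  have := hc.2 y hy
  gcongr

lemma notMem_interior_of_mem_face {K : Set ℂ} {θ : ℝ} {x : ℂ} (hx : x ∈ face K θ) :
    x ∉ interior K := by
  intro hi
  have hcont : Continuous fun r : ℝ => x + r * (⟨Real.cos θ, Real.sin θ⟩ : ℂ) := by fun_prop
  have hmem : ∀ᶠ r : ℝ in nhds 0, x + r * (⟨Real.cos θ, Real.sin θ⟩ : ℂ) ∈ K :=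
    hcont.continuousAt.eventually_mem (by simpa using mem_interior_iff_mem_nhds.1 hi)
  obtain ⟨r, hr, hr0⟩ := ((hmem.filter_mono nhdsWithin_le_nhds).and
    (self_mem_nhdsWithin : Set.Ioi (0 : ℝ) ∈ nhdsWithin 0 (Set.Ioi 0))).exists
  have h := hx.2 _ hr
  rw [dirFun_add] at h
  have : dirFun θ (r * (⟨Real.cos θ, Real.sin θ⟩ : ℂ)) = r := by
    simp [dirFun]
    linear_combination r * Real.cos_sq_add_sin_sq θ
  rw [this] at h
  exact absurd h (by simpa using hr0)

/-- Opposite normals at one point make `dirFun θ` constant on `K`, which would put an interior point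
in a face. -/
lemma notMem_face_add_pi {K : Set ℂ} (hint : (interior K).Nonempty) {θ : ℝ} {x : ℂ}
    (h1 : x ∈ face K θ) : x ∉ face K (θ + Real.pi) := by
  intro h2
  obtain ⟨z, hz⟩ := hint
  refine notMem_interior_of_mem_face (K := K) (θ := θ) (x := z) ⟨interior_subset hz, ?_⟩ hz
  intro y hy
  have h3 := h1.2 y hy
  have h4 := h2.2 z (interior_subset hz)
  simp only [dirFun, Real.cos_add_pi, Real.sin_add_pi] at *
  linarith

/-- Hahn–Banach gives a supporting functional at each frontier point; its representing vector
supplies the normal angle. -/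
lemma frontier_eq_arc {K : Set ℂ} (hK : IsCompact K) (hconv : Convex ℝ K)
    (hint : (interior K).Nonempty) : frontier K = arc K 0 (2 * Real.pi) := by
  rw [hK.isClosed.frontier_eq]
  ext x
  constructor
  · rintro ⟨hxK, hxi⟩
    obtain ⟨f, hf⟩ := geometric_hahn_banach_open_point hconv.interior isOpen_interior hxi
    have hfK : ∀ y ∈ K, f y ≤ f x := by
      intro y hy
      have hy' : y ∈ closure (interior K) := by
        rw [hconv.closure_interior_eq_closure_of_nonempty_interior hint]
        exact subset_closure hy
      exact closure_minimal (fun z hz => (hf z hz).le)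
        (isClosed_le f.continuous continuous_const) hy'
    set w : ℂ := ⟨f 1, f Complex.I⟩
    have hfw : ∀ z : ℂ, f z = ‖w‖ * dirFun (Complex.arg w) z := by
      intro z
      have e : f z = z.re * f 1 + z.im * f Complex.I := by
        conv_lhs => rw [← Complex.re_add_im z]
        rw [map_add, show (z.re : ℂ) = z.re • (1 : ℂ) by simp,
          show (z.im : ℂ) * Complex.I = z.im • Complex.I by simp, map_smul, map_smul,
          smul_eq_mul, smul_eq_mul]
      have h1 : ‖w‖ * Real.cos (Complex.arg w) = f 1 := Complex.norm_mul_cos_arg w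
      have h2 : ‖w‖ * Real.sin (Complex.arg w) = f Complex.I := Complex.norm_mul_sin_arg w
      rw [e, ← h1, ← h2, dirFun]; ring
    have hw : 0 < ‖w‖ := by
      obtain ⟨z, hz⟩ := hint
      have := hf z hz
      rw [hfw, hfw] at this
      rcases (norm_nonneg w).eq_or_lt with h | h
      · simp [← h] at this
      · exact h
    have hface : x ∈ face K (Complex.arg w) := by
      refine ⟨hxK, fun y hy => le_of_mul_le_mul_left ?_ hw⟩
      rw [← hfw, ← hfw]
      exact hfK y hy
    -- `Complex.arg` takes values in (-π, π], so negative angles are shifted by a full turn.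
    rcases le_or_gt 0 (Complex.arg w) with h | h
    · exact ⟨_, ⟨h, by linarith [Complex.arg_le_pi w, Real.pi_pos]⟩, hface⟩
    · refine ⟨Complex.arg w + 2 * Real.pi, ⟨?_, by linarith⟩, ?_⟩
      · linarith [Complex.neg_pi_lt_arg w, Real.pi_pos]
      · rwa [face_add_two_pi]
  · rintro ⟨θ, -, hx⟩
    exact ⟨hx.1, notMem_interior_of_mem_face hx⟩

/-! ### Cutting the boundary at end points of faces. -/

/-- The endpoint of a face in the positive direction. -/
def IsLastPoint (K : Set ℂ) (θ : ℝ) (p : ℂ) : Prop :=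
  p ∈ face K θ ∧ ∀ x ∈ face K θ, tanFun θ x ≤ tanFun θ p

/-- The endpoint of a face in the negative direction. -/
def IsFirstPoint (K : Set ℂ) (θ : ℝ) (p : ℂ) : Prop :=
  p ∈ face K θ ∧ ∀ x ∈ face K θ, tanFun θ p ≤ tanFun θ x

lemma exists_isLastPoint {K : Set ℂ} (hne : K.Nonempty) (hK : IsCompact K) (θ : ℝ) :
    ∃ p, IsLastPoint K θ p := by
  obtain ⟨p, hp, h⟩ := (isCompact_face hK θ).exists_isMaxOn (face_nonempty hne hK θ)
    (continuous_tanFun θ).continuousOn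
  exact ⟨p, hp, fun x hx => h hx⟩

lemma exists_isFirstPoint {K : Set ℂ} (hne : K.Nonempty) (hK : IsCompact K) (θ : ℝ) :
    ∃ p, IsFirstPoint K θ p := by
  obtain ⟨p, hp, h⟩ := (isCompact_face hK θ).exists_isMinOn (face_nonempty hne hK θ)
    (continuous_tanFun θ).continuousOn
  exact ⟨p, hp, fun x hx => h hx⟩

lemma hausdorffMeasure_arc_self {K : Set ℂ} (hne : K.Nonempty) (hK : IsCompact K)
    (hconv : Convex ℝ K) {θ : ℝ} {p q : ℂ} (hp : IsFirstPoint K θ p) (hq : IsLastPoint K θ q) :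
    μH[1] (arc K θ θ) = ENNReal.ofReal (tanFun θ q - tanFun θ p) := by
  apply le_antisymm
  · have := hausdorffMeasure_le_of_subset_arc (K := K) (X := arc K θ θ) (m := θ) (η := 0)
      (a := tanFun θ p) (b := tanFun θ q) le_rfl (by positivity) (by simp) (by
        rintro x ⟨φ, hφ, hx⟩
        obtain rfl : φ = θ := le_antisymm hφ.2 hφ.1
        exact ⟨hp.2 x hx, hq.2 x hx⟩)
    simpa using this
  · refine le_hausdorffMeasure_of_tanFun (m := θ) (c := 0) fun v hv => ?_
    exact exists_mem_arc_tanFun_eq hne hK hconv le_rfl hp.1 hq.1 hv.1.1.le hv.1.2.le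

/-- The condition on the right end of the pieces into which the boundary is cut: the last piece
stops at the face the first one started from. -/
def IsEndPoint (K : Set ℂ) (t : ℝ) (q : ℂ) : Prop :=
  (t < 2 * Real.pi → IsLastPoint K t q) ∧ (t = 2 * Real.pi → IsFirstPoint K t q)

lemma IsEndPoint.mem_face {K : Set ℂ} {t : ℝ} {q : ℂ} (h : IsEndPoint K t q)
    (ht : t ≤ 2 * Real.pi) : q ∈ face K t := by
  rcases ht.lt_or_eq with h' | h'
  · exact (h.1 h').1
  · exact (h.2 h').1

/-- Removing the earlier arc makes consecutive pieces disjoint. By monotonicity, the end points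
bound the tangential coordinate on what remains. -/
lemma hausdorffMeasure_arc_diff_le {K : Set ℂ} {m η : ℝ} (hη0 : 0 < η) (hη : η < Real.pi / 2)
    (hs : 0 ≤ m - η) (ht : m + η ≤ 2 * Real.pi) {p q : ℂ} (hp : IsLastPoint K (m - η) p)
    (hq : IsEndPoint K (m + η) q) :
    μH[1] (arc K 0 (m + η) \ arc K 0 (m - η))
      ≤ ENNReal.ofReal ((tanFun m q - tanFun m p) / Real.cos η) := by
  have key : ∀ x ∈ arc K 0 (m + η) \ arc K 0 (m - η),
      ∃ θ, m - η < θ ∧ θ ≤ m + η ∧ x ∈ face K θ := by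
    rintro x ⟨⟨θ, ⟨h0, h1⟩, hx⟩, hn⟩
    refine ⟨θ, ?_, h1, hx⟩
    by_contra! h
    exact hn ⟨θ, ⟨h0, h⟩, hx⟩
  refine hausdorffMeasure_le_of_subset_arc (K := K) (m := m) hη0.le hη ?_ ?_
  · intro x hx
    obtain ⟨θ, h1, h2, h3⟩ := key x hx
    exact ⟨θ, ⟨h1.le, h2⟩, h3⟩
  · intro x hx
    obtain ⟨θ, h1, h2, h3⟩ := key x hx
    refine ⟨tanFun_le_of_mem_face hη le_rfl h1 h2 hp.1 h3, ?_⟩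
    rcases h2.lt_or_eq with h | rfl
    · exact tanFun_le_of_mem_face hη h1.le h le_rfl h3 (hq.mem_face ht)
    · rcases ht.lt_or_eq with h | h
      · refine tanFun_le_of_mem_same_face ?_ h3 (hq.1 h).1 ((hq.1 h).2 x h3)
        rw [abs_le]; constructor <;> linarith
      -- After a full turn the final face is the face at angle 0, which has already been removed.
      · refine absurd ⟨0, ⟨le_rfl, hs⟩, ?_⟩ hx.2
        rwa [← face_two_pi, ← h]

/-- Intermediate values are attained on the arc; the point is that removing the earlier arc loses at
most one of them, that of the first point `r` of the face at angle 0. -/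
lemma le_hausdorffMeasure_arc_diff {K : Set ℂ} (hne : K.Nonempty) (hK : IsCompact K)
    (hconv : Convex ℝ K) (hint : (interior K).Nonempty)
    {m η : ℝ} (hη0 : 0 < η) (hη : η < Real.pi / 2)
    (hs : 0 ≤ m - η) (ht : m + η ≤ 2 * Real.pi) {p q : ℂ} (hp : IsLastPoint K (m - η) p)
    (hq : IsEndPoint K (m + η) q) :
    ENNReal.ofReal (tanFun m q - tanFun m p) ≤
      μH[1] (arc K 0 (m + η) \ arc K 0 (m - η)) := by
  obtain ⟨r, hr⟩ := exists_isFirstPoint hne hK 0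
  refine le_hausdorffMeasure_of_tanFun (m := m) (c := tanFun m r) ?_
  rintro v ⟨⟨hv1, hv2⟩, hvr⟩
  obtain ⟨x, ⟨θ, ⟨hθ1, hθ2⟩, hx⟩, hxv⟩ := exists_mem_arc_tanFun_eq hne hK hconv
    (by linarith : m - η ≤ m + η) hp.1 (hq.mem_face ht) hv1.le hv2.le
  refine ⟨x, ⟨⟨θ, ⟨by linarith, hθ2⟩, hx⟩, ?_⟩, hxv⟩
  have hxs : x ∉ face K (m - η) := by
    intro h
    have := tanFun_le_of_mem_same_face (m := m) (θ := m - η)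
      (by rw [abs_le]; constructor <;> linarith) h hp.1 (hp.2 x h)
    linarith
  have hθs : m - η < θ := hθ1.lt_of_ne (by rintro rfl; exact hxs hx)
  -- Suppose `x` also has an earlier normal φ. If θ - φ < π, interpolation puts `x` in the initial
  -- face, which was excluded. A difference of π contradicts the interior. If the difference exceeds
  -- π, interpolating the other way round puts `x` in the face at 2π: either θ < 2π and `x` has both
  -- coordinates of `r`, or θ = 2π and `x` cannot precede the first point `q`.
  rintro ⟨φ, ⟨hφ0, hφs⟩, hφ⟩
  rcases lt_trichotomy (θ - φ) Real.pi with h | h | h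
  · exact hxs (mem_face_of_mem_face hφs hθs.le (by linarith) h hφ hx)
  · refine notMem_face_add_pi hint hφ ?_
    rwa [← h, add_sub_cancel]
  · rcases (hθ2.trans ht).lt_or_eq with h2 | h2
    · have hx0 : x ∈ face K (2 * Real.pi) := by
        refine mem_face_of_mem_face (c := φ + 2 * Real.pi) h2.le (by linarith) (by linarith)
          (by linarith) hx ?_
        rwa [face_add_two_pi]
      rw [face_two_pi] at hx0
      have h3 : tanFun 0 x ≤ tanFun 0 r := by
        have h4 := hx.2 r hr.1.1
        have h5 := hx0.2 r hr.1.1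
        have h6 := hr.1.2 x hx.1
        have e : dirFun 0 x = dirFun 0 r := le_antisymm h6 h5
        have hsin : Real.sin θ < 0 := by
          have := Real.sin_pos_of_pos_of_lt_pi (x := θ - Real.pi) (by linarith) (by linarith)
          rw [Real.sin_sub_pi] at this
          linarith
        rw [← zero_add θ, dirFun_angle_add, dirFun_angle_add, e] at h4
        by_contra! h7
        nlinarith
      have h4 := hr.2 x hx0
      have e : dirFun 0 x = dirFun 0 r := le_antisymm (hr.1.2 x hx.1) (hx0.2 r hr.1.1)
      apply hvr
      rw [Set.mem_singleton_iff, ← hxv, ← zero_add m, tanFun_angle_add, tanFun_angle_add, e,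
        le_antisymm h3 h4]
    · have h3 : m + η = 2 * Real.pi := by linarith
      have h4 : θ = m + η := by linarith
      rw [h4] at hx
      have := tanFun_le_of_mem_same_face (m := m)
        (by rw [abs_le]; constructor <;> linarith) (hq.2 h3).1 hx ((hq.2 h3).2 x hx)
      linarith

lemma arc_mono {K : Set ℂ} {a s t : ℝ} (h : s ≤ t) : arc K a s ⊆ arc K a t :=
  fun _ ⟨θ, hθ, hx⟩ => ⟨θ, ⟨hθ.1, hθ.2.trans h⟩, hx⟩

/-! ### Circumscribed polygons and the perimeter. -/

lemma supportFun_eq {K : Set ℂ} {θ : ℝ} {x : ℂ} (hx : x ∈ face K θ) :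
    supportFun K θ = dirFun θ x :=
  IsGreatest.csSup_eq ⟨⟨x, hx.1, rfl⟩, by rintro _ ⟨y, hy, rfl⟩; exact hx.2 y hy⟩

/-- Perimeter of the polygon circumscribed about `K` with `N` normals at equal angles, multiplied
by `cos (π / N)`. -/
noncomputable def polygonSum (K : Set ℂ) (N : ℕ) : ℝ :=
  ∑ i ∈ Finset.range N, Real.sin (Real.pi / N) *
    (supportFun K (2 * Real.pi / N * i) + supportFun K (2 * Real.pi / N * (i + 1 : ℕ)))

/-- Maximizers of `dirFun θ` on `K` and `L` add up to a maximizer on `K + L`. -/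
lemma polygonSum_add {K L : Set ℂ} (hK : IsCompact K) (hL : IsCompact L) (hKne : K.Nonempty)
    (hLne : L.Nonempty) (N : ℕ) : polygonSum (K + L) N = polygonSum K N + polygonSum L N := by
  have h : ∀ θ, supportFun (K + L) θ = supportFun K θ + supportFun L θ := by
    intro θ
    obtain ⟨p, hp⟩ := face_nonempty hKne hK θ
    obtain ⟨q, hq⟩ := face_nonempty hLne hL θ
    rw [supportFun_eq hp, supportFun_eq hq, ← dirFun_add]
    refine supportFun_eq ⟨Set.add_mem_add hp.1 hq.1, ?_⟩
    rintro _ ⟨x, hx, y, hy, rfl⟩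
    rw [dirFun_add, dirFun_add]
    exact add_le_add (hp.2 x hx) (hq.2 y hy)
  simp only [polygonSum, h, ← Finset.sum_add_distrib]
  exact Finset.sum_congr rfl fun i _ => by ring

/-- Three normals suffice for the half-angle π / N to stay below π / 2, as the estimates on the
pieces require. -/
lemma hausdorffMeasure_frontier_bounds {K : Set ℂ} (hne : K.Nonempty) (hK : IsCompact K)
    (hconv : Convex ℝ K) (hint : (interior K).Nonempty) {N : ℕ} (hN : 3 ≤ N) :
    0 ≤ polygonSum K N ∧ ENNReal.ofReal (polygonSum K N) ≤ μH[1] (frontier K) ∧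
      μH[1] (frontier K) ≤ ENNReal.ofReal (polygonSum K N / Real.cos (Real.pi / N)) := by
  have hN0 : (0 : ℝ) < N := by positivity
  have hN3 : (3 : ℝ) ≤ N := by exact_mod_cast hN
  set η := Real.pi / N with hηdef
  have hη0 : 0 < η := by positivity
  have hη : η < Real.pi / 2 := by
    rw [hηdef]
    exact div_lt_div_of_pos_left Real.pi_pos two_pos (by linarith)
  have hcos : 0 < Real.cos η := Real.cos_pos_of_mem_Ioo ⟨by linarith, hη⟩
  set T : ℕ → ℝ := fun i => 2 * Real.pi / N * i with hT
  have hTη : ∀ i, T i = 2 * η * i := fun i => by simp only [hT, hηdef]; ring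
  have hTN : T N = 2 * Real.pi := by simp only [hT]; field_simp
  have hT0 : T 0 = 0 := by simp [hT]
  have hTlt : ∀ i < N, T i < 2 * Real.pi := by
    intro i hi
    rw [← hTN, hTη, hTη]
    have : (i : ℝ) < N := by exact_mod_cast hi
    nlinarith
  have hTnn : ∀ i, 0 ≤ T i := fun i => by rw [hTη]; positivity
  have hend : ∀ i, ∃ q, IsEndPoint K (T i) q := by
    intro i
    by_cases h : T i < 2 * Real.pi
    · obtain ⟨q, hq⟩ := exists_isLastPoint hne hK (T i)
      exact ⟨q, fun _ => hq, fun h' => absurd h (by linarith)⟩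
    · obtain ⟨q, hq⟩ := exists_isFirstPoint hne hK (T i)
      exact ⟨q, fun h' => absurd h' h, fun _ => hq⟩
  choose e he using hend
  set M : ℕ → ℝ := fun i => T i + η
  have hM1 : ∀ i, M i - η = T i := fun i => by simp only [M]; ring
  have hM2 : ∀ i, M i + η = T (i + 1) := fun i => by
    simp only [M, hTη]; push_cast; ring
  set ℓ : ℕ → ℝ := fun i => tanFun (M i) (e (i + 1)) - tanFun (M i) (e i)
  have hTle : ∀ i < N, T (i + 1) ≤ 2 * Real.pi := by
    intro i hi
    rcases (Nat.succ_le_of_lt hi).lt_or_eq with h | h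
    · exact (hTlt _ h).le
    · rw [← hTN, ← h]
  have hlast : ∀ i < N, IsLastPoint K (T i) (e i) := fun i hi => (he i).1 (hTlt i hi)
  have hfirst : IsFirstPoint K 0 (e N) := by
    have := (he N).2 hTN
    rw [hTN, ← zero_add (2 * Real.pi)] at this
    simpa only [IsFirstPoint, face_add_two_pi, tanFun_add_two_pi] using this
  have hlow : ∀ i < N, ENNReal.ofReal (ℓ i) ≤ μH[1] (arc K 0 (T (i + 1)) \ arc K 0 (T i)) := by
    intro i hi
    have := le_hausdorffMeasure_arc_diff (m := M i) (η := η) (p := e i) (q := e (i + 1)) hne hK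
      hconv hint hη0 hη (by rw [hM1]; exact hTnn i) (by rw [hM2]; exact hTle i hi)
      (by rw [hM1]; exact hlast i hi) (by rw [hM2]; exact he _)
    rwa [hM1, hM2] at this
  have hup : ∀ i < N, μH[1] (arc K 0 (T (i + 1)) \ arc K 0 (T i))
      ≤ ENNReal.ofReal (ℓ i / Real.cos η) := by
    intro i hi
    have := hausdorffMeasure_arc_diff_le (K := K) (m := M i) (η := η) (p := e i) (q := e (i + 1))
      hη0 hη (by rw [hM1]; exact hTnn i) (by rw [hM2]; exact hTle i hi)
      (by rw [hM1]; exact hlast i hi) (by rw [hM2]; exact he _)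
    rwa [hM1, hM2] at this
  have hℓ0 : ∀ i < N, 0 ≤ ℓ i := by
    intro i hi
    refine sub_nonneg.2 (tanFun_le_of_mem_face (m := M i) (θ := T i) (φ := T (i + 1)) hη
      (hM1 i).le ?_ (hM2 i).ge (hlast i hi).1 ((he _).mem_face (hTle i hi)))
    rw [← hM1, ← hM2]; linarith
  set F := tanFun 0 (e 0) - tanFun 0 (e N)
  have hN0' : 0 < N := by omega
  have hlast0 : IsLastPoint K 0 (e 0) := by
    have := hlast 0 hN0'
    rwa [hT0] at this
  have hF0 : 0 ≤ F := sub_nonneg.2 (hlast0.2 _ hfirst.1)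
  have hF : μH[1] (arc K 0 0) = ENNReal.ofReal F :=
    hausdorffMeasure_arc_self hne hK hconv hfirst hlast0
  have hsum : ∀ n, μH[1] (arc K 0 (T n)) = μH[1] (arc K 0 0)
      + ∑ i ∈ Finset.range n, μH[1] (arc K 0 (T (i + 1)) \ arc K 0 (T i)) := by
    intro n
    induction n with
    | zero => simp [hT0]
    | succ n ih =>
      have hsub : arc K 0 (T n) ⊆ arc K 0 (T (n + 1)) := arc_mono (by
        rw [← hM1, ← hM2]; linarith)
      rw [Finset.sum_range_succ, ← add_assoc, ← ih,
        ← measure_inter_add_sdiff (μ := μH[1]) (arc K 0 (T (n + 1)))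
          (isCompact_arc hK 0 (T n)).isClosed.measurableSet, Set.inter_eq_self_of_subset_right hsub]
  have htotal : ∑ i ∈ Finset.range N, ℓ i = polygonSum K N - Real.cos η * F := by
    -- The middle normal is +η from `T i` and -η from `T (i + 1)`. Expanding in those two frames
    -- turns the normal components into support values and leaves a telescoping tangential part.
    have hterm : ∀ i ∈ Finset.range N, ℓ i = Real.sin η * (supportFun K (T i)
        + supportFun K (T (i + 1)))
        + Real.cos η * (tanFun (T (i + 1)) (e (i + 1)) - tanFun (T i) (e i)) := by
      intro i hi
      have hi := Finset.mem_range.1 hi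
      rw [supportFun_eq (hlast i hi).1, supportFun_eq ((he _).mem_face (hTle i hi))]
      simp only [ℓ]
      conv_lhs => rw [show tanFun (M i) (e (i + 1)) = tanFun (T (i + 1) + -η) (e (i + 1)) by
        rw [← hM2]; ring_nf]
      rw [tanFun_angle_add, Real.cos_neg, Real.sin_neg, show M i = T i + η from rfl,
        tanFun_angle_add]
      ring
    rw [Finset.sum_congr rfl hterm, Finset.sum_add_distrib, ← Finset.mul_sum (a := Real.cos η),
      Finset.sum_range_sub (fun i => tanFun (T i) (e i)), hTN, hT0, ← zero_add (2 * Real.pi),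
      tanFun_add_two_pi, polygonSum]
    simp only [F, hT, hηdef]
    ring
  rw [frontier_eq_arc hK hconv hint, ← hTN, hsum, hF]
  have hcos1 := Real.cos_le_one η
  -- The face at angle 0 enters with weight cos η, but its length is exactly `F`. Since 0 < cos η ≤
  -- 1, this fits both bounds.
  have hHF : polygonSum K N = ∑ i ∈ Finset.range N, ℓ i + Real.cos η * F := by rw [htotal]; ring
  refine ⟨?_, ?_, ?_⟩
  · rw [hHF]
    exact add_nonneg (Finset.sum_nonneg fun i hi => hℓ0 i (Finset.mem_range.1 hi))
      (mul_nonneg hcos.le hF0)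
  · calc ENNReal.ofReal (polygonSum K N)
        ≤ ENNReal.ofReal (F + ∑ i ∈ Finset.range N, ℓ i) := by
          apply ENNReal.ofReal_le_ofReal
          rw [hHF]; nlinarith
      _ = ENNReal.ofReal F + ∑ i ∈ Finset.range N, ENNReal.ofReal (ℓ i) := by
          rw [ENNReal.ofReal_add hF0 (Finset.sum_nonneg fun i hi => hℓ0 i (Finset.mem_range.1 hi)),
            ENNReal.ofReal_sum_of_nonneg fun i hi => hℓ0 i (Finset.mem_range.1 hi)]
      _ ≤ _ := by
          gcongr with i hi
          exact hlow i (Finset.mem_range.1 hi)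
  · calc _ ≤ ENNReal.ofReal F + ∑ i ∈ Finset.range N, ENNReal.ofReal (ℓ i / Real.cos η) := by
          gcongr with i hi
          exact hup i (Finset.mem_range.1 hi)
      _ = ENNReal.ofReal (F + ∑ i ∈ Finset.range N, ℓ i / Real.cos η) := by
          have hnn : ∀ i ∈ Finset.range N, 0 ≤ ℓ i / Real.cos η := fun i hi =>
            div_nonneg (hℓ0 i (Finset.mem_range.1 hi)) hcos.le
          rw [ENNReal.ofReal_add hF0 (Finset.sum_nonneg hnn), ENNReal.ofReal_sum_of_nonneg hnn]
      _ = _ := by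
          rw [hHF, ← Finset.sum_div]
          congr 1
          field_simp
          ring

/-- The perimeters of circumscribed polygons converge to the perimeter. -/
lemma tendsto_polygonSum_of_interior {K : Set ℂ} (hne : K.Nonempty) (hK : IsCompact K)
    (hconv : Convex ℝ K) (hint : (interior K).Nonempty) :
    perimeter K ≠ ∞ ∧
      Filter.Tendsto (polygonSum K) Filter.atTop (nhds (perimeter K).toReal) := by
  have hP : perimeter K = μH[1] (frontier K) := by simp [perimeter, hint]
  rw [hP]
  have hfin : μH[1] (frontier K) ≠ ∞ := ne_top_of_le_ne_top ENNReal.ofReal_ne_top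
    (hausdorffMeasure_frontier_bounds hne hK hconv hint le_rfl).2.2
  refine ⟨hfin, ?_⟩
  set P := (μH[1] (frontier K)).toReal
  have hbd : ∀ N : ℕ, 3 ≤ N → P * Real.cos (Real.pi / N) ≤ polygonSum K N ∧ polygonSum K N ≤ P := by
    intro N hN
    obtain ⟨h, h1, h2⟩ := hausdorffMeasure_frontier_bounds hne hK hconv hint hN
    have hN3 : (3 : ℝ) ≤ N := by exact_mod_cast hN
    have hcos : 0 < Real.cos (Real.pi / N) := by
      refine Real.cos_pos_of_mem_Ioo ⟨?_, ?_⟩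
      · have : 0 < Real.pi / N := by positivity
        linarith [Real.pi_pos]
      · exact div_lt_div_of_pos_left Real.pi_pos two_pos (by linarith)
    refine ⟨?_, (ENNReal.ofReal_le_iff_le_toReal hfin).1 h1⟩
    rw [← le_div_iff₀ hcos]
    exact ENNReal.toReal_le_of_le_ofReal (by positivity) h2
  have hlim : Filter.Tendsto (fun N : ℕ => P * Real.cos (Real.pi / N)) Filter.atTop (nhds P) := by
    have h1 : Filter.Tendsto (fun N : ℕ => Real.pi / (N : ℝ)) Filter.atTop (nhds 0) :=
      tendsto_const_div_atTop_nhds_zero_nat Real.pi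
    have h2 := ((Real.continuous_cos.tendsto 0).comp h1).const_mul P
    simpa using h2
  refine tendsto_of_tendsto_of_tendsto_of_le_of_le' hlim tendsto_const_nhds ?_ ?_
  · filter_upwards [Filter.eventually_ge_atTop 3] with N hN using (hbd N hN).1
  · filter_upwards [Filter.eventually_ge_atTop 3] with N hN using (hbd N hN).2

/-! ### Rectangles and sets without interior. -/

/-- The closed rectangle with corner `p` and sides `a` in the direction `u`, `b` in the direction
`I * u`. -/
def rectangle (p u : ℂ) (a b : ℝ) : Set ℂ :=
  (fun z => p + u * z) '' (Set.Icc 0 a ×ℂ Set.Icc 0 b)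

lemma rectangle_add_rectangle (p q u : ℂ) {a b c d : ℝ} (ha : 0 ≤ a) (hb : 0 ≤ b) (hc : 0 ≤ c)
    (hd : 0 ≤ d) :
    rectangle p u a b + rectangle q u c d = rectangle (p + q) u (a + c) (b + d) := by
  ext x
  constructor
  · rintro ⟨_, ⟨z, ⟨⟨h1, h2⟩, h3, h4⟩, rfl⟩, _, ⟨w, ⟨⟨h5, h6⟩, h7, h8⟩, rfl⟩, rfl⟩
    refine ⟨z + w, ⟨⟨?_, ?_⟩, ?_, ?_⟩, by ring⟩ <;> simp only [Complex.add_re, Complex.add_im] <;>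
      linarith
  · rintro ⟨z, ⟨h1, h2⟩, rfl⟩
    have e1 : Set.Icc 0 a + Set.Icc 0 c = Set.Icc 0 (a + c) := by
      rw [Set.Icc_add_Icc ha hc, add_zero]
    have e2 : Set.Icc 0 b + Set.Icc 0 d = Set.Icc 0 (b + d) := by
      rw [Set.Icc_add_Icc hb hd, add_zero]
    have h1 : z.re ∈ Set.Icc 0 (a + c) := h1
    have h2 : z.im ∈ Set.Icc 0 (b + d) := h2
    rw [← e1] at h1
    rw [← e2] at h2
    obtain ⟨x, hx, x', hx', hxx⟩ := h1
    obtain ⟨y, hy, y', hy', hyy⟩ := h2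
    refine ⟨_, ⟨⟨x, y⟩, ⟨hx, hy⟩, rfl⟩, _, ⟨⟨x', y'⟩, ⟨hx', hy'⟩, rfl⟩, ?_⟩
    have hz : z = ⟨x, y⟩ + ⟨x', y'⟩ := Complex.ext hxx.symm hyy.symm
    rw [hz]
    ring

lemma rectangle_nonempty (p u : ℂ) {a b : ℝ} (ha : 0 ≤ a) (hb : 0 ≤ b) :
    (rectangle p u a b).Nonempty :=
  ⟨_, 0, ⟨⟨le_rfl, ha⟩, le_rfl, hb⟩, rfl⟩

lemma isCompact_rectangle (p u : ℂ) (a b : ℝ) : IsCompact (rectangle p u a b) :=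
  (isCompact_Icc.reProdIm isCompact_Icc).image (by fun_prop)

lemma convex_rectangle (p u : ℂ) (a b : ℝ) : Convex ℝ (rectangle p u a b) := by
  have h : rectangle p u a b
      = (fun z => p + z) '' (LinearMap.mulLeft ℝ u '' (Set.Icc 0 a ×ℂ Set.Icc 0 b)) := by
    rw [Set.image_image]; rfl
  rw [h]
  refine Convex.translate (Convex.linear_image ?_ _) p
  exact ((convex_Icc 0 a).linear_preimage Complex.reLm).inter
    ((convex_Icc 0 b).linear_preimage Complex.imLm)

/-- The rotation by `u` followed by the translation by `p`. -/
noncomputable def rotationTranslation (p : ℂ) (u : Circle) : ℂ ≃ᵢ ℂ :=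
  (rotation u).toIsometryEquiv.trans (IsometryEquiv.addLeft p)

lemma rectangle_eq_image (p : ℂ) (u : Circle) (a b : ℝ) :
    rectangle p u a b = rotationTranslation p u '' (Set.Icc 0 a ×ℂ Set.Icc 0 b) := by
  have h : ∀ z, rotationTranslation p u z = p + u * z := fun _ => rfl
  simp only [rectangle, h]

lemma hausdorffMeasure_Icc_reProdIm_singleton (a c : ℝ) :
    μH[1] (Set.Icc 0 a ×ℂ {c}) = ENNReal.ofReal a := by
  have h : Isometry fun x : ℝ => (⟨x, c⟩ : ℂ) := Isometry.of_dist_eq fun _ _ =>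
    Complex.dist_of_im_eq rfl
  have e : Set.Icc 0 a ×ℂ {c} = (fun x : ℝ => (⟨x, c⟩ : ℂ)) '' Set.Icc 0 a := by
    ext z
    constructor
    · rintro ⟨h1, h2⟩
      exact ⟨z.re, h1, Complex.ext rfl (Eq.symm h2)⟩
    · rintro ⟨x, hx, rfl⟩
      exact ⟨hx, rfl⟩
  rw [e, h.hausdorffMeasure_image (Or.inl zero_le_one), hausdorffMeasure_real, Real.volume_Icc,
    sub_zero]

lemma hausdorffMeasure_singleton_reProdIm_Icc (b c : ℝ) :
    μH[1] ({c} ×ℂ Set.Icc 0 b) = ENNReal.ofReal b := by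
  have h : Isometry fun x : ℝ => (⟨c, x⟩ : ℂ) := Isometry.of_dist_eq fun _ _ =>
    Complex.dist_of_re_eq rfl
  have e : {c} ×ℂ Set.Icc 0 b = (fun x : ℝ => (⟨c, x⟩ : ℂ)) '' Set.Icc 0 b := by
    ext z
    constructor
    · rintro ⟨h1, h2⟩
      exact ⟨z.im, h2, Complex.ext (Eq.symm h1) rfl⟩
    · rintro ⟨x, hx, rfl⟩
      exact ⟨rfl, hx⟩
  rw [e, h.hausdorffMeasure_image (Or.inl zero_le_one), hausdorffMeasure_real, Real.volume_Icc,
    sub_zero]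

/-- Horizontal and vertical sides meet only in the four corners, a null set for length. -/
lemma hausdorffMeasure_frontier_Icc_reProdIm_Icc {a b : ℝ} (ha : 0 < a) (hb : 0 < b) :
    μH[1] (frontier (Set.Icc 0 a ×ℂ Set.Icc 0 b)) = ENNReal.ofReal (2 * (a + b)) := by
  have : NullSingletonClass (μH[1] : Measure ℂ) := Measure.nullSingletonClass_hausdorff ℂ one_pos
  rw [Complex.frontier_reProdIm, frontier_Icc ha.le, frontier_Icc hb.le, closure_Icc, closure_Icc]
  have e1 : Set.Icc 0 a ×ℂ {0, b} = Set.Icc 0 a ×ℂ {0} ∪ Set.Icc 0 a ×ℂ {b} := by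
    ext z; simp only [Complex.mem_reProdIm, Set.mem_union, Set.mem_insert_iff,
      Set.mem_singleton_iff]; tauto
  have e2 : {0, a} ×ℂ Set.Icc 0 b = {0} ×ℂ Set.Icc 0 b ∪ {a} ×ℂ Set.Icc 0 b := by
    ext z; simp only [Complex.mem_reProdIm, Set.mem_union, Set.mem_insert_iff,
      Set.mem_singleton_iff]; tauto
  have d1 : Disjoint (Set.Icc 0 a ×ℂ {0}) (Set.Icc 0 a ×ℂ {b}) := by
    refine Set.disjoint_left.2 fun z h1 h2 => hb.ne ?_
    rw [← show z.im = 0 from h1.2, show z.im = b from h2.2]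
  have d2 : Disjoint ({0} ×ℂ Set.Icc 0 b) ({a} ×ℂ Set.Icc 0 b) := by
    refine Set.disjoint_left.2 fun z h1 h2 => ha.ne ?_
    rw [← show z.re = 0 from h1.1, show z.re = a from h2.1]
  have m1 : MeasurableSet (Set.Icc 0 a ×ℂ {b}) :=
    (isClosed_Icc.reProdIm isClosed_singleton).measurableSet
  have m2 : MeasurableSet ({a} ×ℂ Set.Icc 0 b) :=
    (isClosed_singleton.reProdIm isClosed_Icc).measurableSet
  have m3 : MeasurableSet ({0, a} ×ℂ Set.Icc 0 b) :=
    ((Set.toFinite {0, a}).isClosed.reProdIm isClosed_Icc).measurableSet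
  have d3 : AEDisjoint μH[1] (Set.Icc 0 a ×ℂ {0, b}) ({0, a} ×ℂ Set.Icc 0 b) := by
    refine Set.Finite.measure_zero (Set.Finite.subset (s := {0, a} ×ℂ {0, b}) ?_ ?_) _
    · refine Set.Finite.subset (Set.toFinite
        ((fun q : ℝ × ℝ => (⟨q.1, q.2⟩ : ℂ)) '' (({0, a} : Set ℝ) ×ˢ ({0, b} : Set ℝ)))) ?_
      exact fun z hz => ⟨(z.re, z.im), hz, rfl⟩
    · exact fun z hz => ⟨hz.2.1, hz.1.2⟩
  rw [measure_union₀ m3.nullMeasurableSet d3, e1, e2, measure_union d1 m1, measure_union d2 m2,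
    hausdorffMeasure_Icc_reProdIm_singleton, hausdorffMeasure_Icc_reProdIm_singleton,
    hausdorffMeasure_singleton_reProdIm_Icc, hausdorffMeasure_singleton_reProdIm_Icc,
    ← ENNReal.ofReal_add ha.le ha.le, ← ENNReal.ofReal_add hb.le hb.le,
    ← ENNReal.ofReal_add (by positivity) (by positivity)]
  congr 1; ring

lemma interior_rectangle_nonempty (p : ℂ) (u : Circle) {a b : ℝ} (ha : 0 < a) (hb : 0 < b) :
    (interior (rectangle p u a b)).Nonempty := by
  rw [rectangle_eq_image, ← IsometryEquiv.coe_toHomeomorph, ← Homeomorph.image_interior,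
    Complex.interior_reProdIm, interior_Icc, interior_Icc]
  exact ⟨_, ⟨a / 2, b / 2⟩, ⟨⟨by simpa, by simpa⟩, by simpa, by simpa⟩, rfl⟩

lemma perimeter_rectangle (p : ℂ) (u : Circle) {a b : ℝ} (ha : 0 < a) (hb : 0 < b) :
    perimeter (rectangle p u a b) = ENNReal.ofReal (2 * (a + b)) := by
  simp only [perimeter, interior_rectangle_nonempty p u ha hb, if_true]
  rw [rectangle_eq_image, ← IsometryEquiv.coe_toHomeomorph, ← Homeomorph.image_frontier,
    IsometryEquiv.coe_toHomeomorph, IsometryEquiv.hausdorffMeasure_image,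
    hausdorffMeasure_frontier_Icc_reProdIm_Icc ha hb]

/-- Without interior the affine span is proper, so `K` is collinear; in an isometric parameter on
the line it is a compact interval. -/
lemma exists_eq_rectangle {K : Set ℂ} (hne : K.Nonempty) (hK : IsCompact K) (hconv : Convex ℝ K)
    (hint : ¬ (interior K).Nonempty) :
    ∃ (p : ℂ) (u : Circle) (r : ℝ), 0 ≤ r ∧ K = rectangle p u r 0 := by
  obtain ⟨p, hp⟩ := hne
  have hcol : Collinear ℝ K := by
    rw [hconv.interior_nonempty_iff_affineSpan_eq_top] at hint
    rw [collinear_iff_finrank_le_one]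
    have hlt : vectorSpan ℝ K < ⊤ := by
      rw [lt_top_iff_ne_top, ← direction_affineSpan, ne_eq,
        AffineSubspace.direction_eq_top_iff_of_nonempty ((affineSpan_nonempty ℝ).2 ⟨p, hp⟩)]
      exact hint
    have := Submodule.finrank_lt hlt.ne
    rw [Complex.finrank_real_complex] at this
    omega
  obtain ⟨v, hv⟩ := (collinear_iff_of_mem hp).1 hcol
  obtain ⟨u, hu⟩ : ∃ u : Circle, ∀ x ∈ K, ∃ t : ℝ, x = p + u * t := by
    -- A single point has no direction, and any unit vector serves.
    by_cases hv0 : v = 0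
    · refine ⟨1, fun x hx => ⟨0, ?_⟩⟩
      obtain ⟨r, hr⟩ := hv x hx
      simpa [hv0] using hr
    · have hn : ‖v‖ ≠ 0 := norm_ne_zero_iff.2 hv0
      refine ⟨⟨v / ‖v‖, by simp [Submonoid.unitSphere, hn]⟩, fun x hx => ?_⟩
      obtain ⟨r, hr⟩ := hv x hx
      refine ⟨r * ‖v‖, ?_⟩
      have hn' : (‖v‖ : ℂ) ≠ 0 := by exact_mod_cast hn
      rw [hr]
      simp
      field_simp
      ring
  have hg : Isometry fun t : ℝ => p + u * (t : ℂ) := Isometry.of_dist_eq fun x y => by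
    rw [dist_add_left, dist_eq_norm, ← mul_sub, norm_mul, Circle.norm_coe, one_mul,
      ← Complex.ofReal_sub, Complex.norm_real, Real.dist_eq, Real.norm_eq_abs]
  set A : Set ℝ := (fun t : ℝ => p + u * (t : ℂ)) ⁻¹' K
  have hAK : IsCompact A := hg.isClosedEmbedding.isCompact_preimage hK
  have hAc : Convex ℝ A := by
    intro x hx y hy a b ha hb hab
    have h := hconv hx hy ha hb hab
    have hab' : (a : ℂ) + b = 1 := by exact_mod_cast hab
    have e : a • (p + u * (x : ℂ)) + b • (p + u * (y : ℂ)) = p + u * ((a • x + b • y : ℝ) : ℂ) := by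
      simp only [Complex.real_smul, smul_eq_mul]
      push_cast
      linear_combination p * hab'
    exact (congrArg (· ∈ K) e).mp h
  have hAne : A.Nonempty := ⟨0, by simpa [A] using hp⟩
  have hAI := eq_Icc_of_connected_compact (hAc.isConnected hAne) hAK
  set s := sInf A
  set t := sSup A
  have hst : s ≤ t := by
    rw [hAI] at hAne
    exact Set.nonempty_Icc.1 hAne
  refine ⟨p + u * s, u, t - s, sub_nonneg.2 hst, ?_⟩
  ext x
  constructor
  · intro hx
    obtain ⟨y, rfl⟩ := hu x hx
    have hy : y ∈ A := hx
    rw [hAI] at hy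
    refine ⟨(y - s : ℝ), ⟨⟨?_, ?_⟩, ?_⟩, ?_⟩
    · simpa using hy.1
    · simpa using hy.2
    · simp
    · push_cast; ring
  · rintro ⟨z, ⟨⟨h1, h2⟩, h3, h4⟩, rfl⟩
    have hz : z = (z.re : ℂ) := Complex.ext rfl (le_antisymm h4 h3)
    have hm : s + z.re ∈ A := by
      rw [hAI]
      constructor <;> linarith
    have : p + u * ((s + z.re : ℝ) : ℂ) ∈ K := hm
    rw [hz]
    push_cast at this
    convert this using 1
    ring

/-- The perimeters of circumscribed polygons converge to the perimeter. -/
lemma tendsto_polygonSum {K : Set ℂ} (hne : K.Nonempty) (hK : IsCompact K)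
    (hconv : Convex ℝ K) :
    perimeter K ≠ ∞ ∧
      Filter.Tendsto (polygonSum K) Filter.atTop (nhds (perimeter K).toReal) := by
  by_cases hint : (interior K).Nonempty
  · exact tendsto_polygonSum_of_interior hne hK hconv hint
  obtain ⟨p, u, r, hr, hKr⟩ := exists_eq_rectangle hne hK hconv hint
  have hP : perimeter K = ENNReal.ofReal (2 * r) := by
    simp only [perimeter, hint, if_false]
    rw [hKr, rectangle_eq_image, IsometryEquiv.hausdorffMeasure_image, Set.Icc_self,
      hausdorffMeasure_Icc_reProdIm_singleton, ENNReal.ofReal_mul zero_le_two,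
      ENNReal.ofReal_ofNat]
  rw [hP]
  refine ⟨ENNReal.ofReal_ne_top, ?_⟩
  rw [ENNReal.toReal_ofReal (by positivity)]
  have hlim : ∀ (q : ℂ) {a b : ℝ}, 0 < a → 0 < b →
      Filter.Tendsto (polygonSum (rectangle q u a b)) Filter.atTop (nhds (2 * (a + b))) := by
    intro q a b ha hb
    have := (tendsto_polygonSum_of_interior (rectangle_nonempty q u ha.le hb.le)
      (isCompact_rectangle q u a b) (convex_rectangle q u a b)
      (interior_rectangle_nonempty q u ha hb)).2
    rwa [perimeter_rectangle q u ha hb, ENNReal.toReal_ofReal (by positivity)] at this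
  -- Adding the unit square in the same orientation thickens the segment to an (r + 1) by 1
  -- rectangle, for which the limit is known.
  have hadd : ∀ N, polygonSum K N
      = polygonSum (rectangle p u (r + 1) 1) N - polygonSum (rectangle 0 u 1 1) N := by
    intro N
    have h := polygonSum_add hK (isCompact_rectangle 0 u 1 1) hne
      (rectangle_nonempty 0 u zero_le_one zero_le_one) N
    have e : K + rectangle 0 u 1 1 = rectangle p u (r + 1) 1 := by
      rw [hKr, rectangle_add_rectangle p 0 u hr le_rfl zero_le_one zero_le_one, add_zero, zero_add]
    rw [e] at h
    linarith
  have h := (hlim p (a := r + 1) (b := 1) (by positivity) one_pos).sub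
    (hlim 0 (a := 1) (b := 1) one_pos one_pos)
  rw [show 2 * r = 2 * (r + 1 + 1) - 2 * (1 + 1) by ring]
  exact h.congr fun N => (hadd N).symm

theorem mainTheorem7 (S₁ S₂ : Set ℂ)
    (hne₁ : S₁.Nonempty) (hne₂ : S₂.Nonempty)
    (hcpt₁ : IsCompact S₁) (hcpt₂ : IsCompact S₂)
    (hconv₁ : Convex ℝ S₁) (hconv₂ : Convex ℝ S₂) :
    perimeter S₁ ≠ ∞ ∧ perimeter S₂ ≠ ∞ ∧
      perimeter (S₁ + S₂) = perimeter S₁ + perimeter S₂ := by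
  obtain ⟨hf₁, hl₁⟩ := tendsto_polygonSum hne₁ hcpt₁ hconv₁
  obtain ⟨hf₂, hl₂⟩ := tendsto_polygonSum hne₂ hcpt₂ hconv₂
  obtain ⟨hf, hl⟩ := tendsto_polygonSum (hne₁.add hne₂) (hcpt₁.add hcpt₂) (hconv₁.add hconv₂)
  refine ⟨hf₁, hf₂, ?_⟩
  have h := tendsto_nhds_unique hl
    ((hl₁.add hl₂).congr fun N => (polygonSum_add hcpt₁ hcpt₂ hne₁ hne₂ N).symm)
  rw [← ENNReal.toReal_add hf₁ hf₂] at h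
  exact (ENNReal.toReal_eq_toReal_iff' hf (ENNReal.add_ne_top.2 ⟨hf₁, hf₂⟩)).1 h
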